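/- Let $K$ be an algebraically closed field of characteristic zero and let $Q$ be a Euclidean quiver without oriented cycles, that is, a finite acyclic quiver whose underlying graph is an extended Dynkin diagram of type $\widetilde A_n$ ($n\ge 1$), $\widetilde D_n$ ($n\ge 4$), $\widetilde E_6$, $\widetilde E_7$ or $\widetilde E_8$. Write $Q_0$ and $Q_1$ for its sets of vertices and arrows and $ta, ha$ for the tail and head of $a\in Q_1$, and let $$\langle\alpha,\beta\rangle=\sum_{x\in Q_0}\alpha(x)\beta(x)-\sum_{a\in Q_1}\alpha(ta)\beta(ha)\qquad(\alpha,\beta\in\mathbb Z^{Q_0})$$ be the Euler form. All representations are finite-dimensional representations of $Q$ over $K$. A representation $V$ is Schur if $\operatorname{End}_Q(V)\simeq K$, and it is exceptional if it is Schur and $\operatorname{Ext}^1_Q(V,V)=0$. Let $\delta$ be the unique imaginary Schur root of $Q$, i.e. the unique dimension vector of a Schur representation with $\langle\delta,\delta\rangle\le 0$. The defect of $V$ is $\langle\delta,\underline{\dim}\,V\rangle$, and $V$ is called preprojective (respectively preinjective) if all indecomposable direct summands of $V$ have negative (respectively positive) defect. Let $V_1,\dots,V_r$ be Schur representations of $Q$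 with $\operatorname{Hom}_Q(V_i,V_j)=0$ for all $i\ne j$ (an orthogonal Schur sequence). Assume that all the $V_i$ are preprojective, or that all the $V_i$ are preinjective. Then there is a permutation $\sigma$ of $\{1,\dots,r\}$ such that $(V_{\sigma(1)},\dots,V_{\sigma(r)})$ is an orthogonal exceptional sequence: every $V_i$ is exceptional, $\operatorname{Hom}_Q(V_{\sigma(i)},V_{\sigma(j)})=0$ for all $i\neq j$, and $\operatorname{Ext}^1_Q(V_{\sigma(i)},V_{\sigma(j)})=0$ for all $i<j$. -/

import Mathlib

open CategoryTheory CategoryTheory.Limits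

universe u v w

noncomputable section

/-! ### Quivers -/

section Quivers

variable (Q : Type v) [Quiver.{w} Q]

/-- `Q` has no oriented cycles: every closed path is trivial. -/
def IsAcyclicQuiver : Prop :=
  ∀ (x : Q) (p : Quiver.Path x x), p = Quiver.Path.nil

variable [Fintype Q] [∀ x y : Q, Fintype (x ⟶ y)]

/-- The edges of the underlying (undirected) multigraph of `Q`, with multiplicity: each arrow
`x ⟶ y` contributes one edge joining `x` and `y`. -/
def underlyingEdges : Multiset (Sym2 Q) :=
  (Finset.univ : Finset (Σ x y : Q, x ⟶ y)).val.map fun a => s(a.1, a.2.1)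

/-- The Euclidean (extended Dynkin, affine simply laced) diagrams. `IsEuclideanDiagram N E` says
that the multigraph with vertices `0, …, N - 1` and multiset of edges `E` is one of
the standard drawings of `Ã_n` (`n ≥ 1`), `D̃_n` (`n ≥ 4`), `Ẽ_6`, `Ẽ_7`, `Ẽ_8`. -/
inductive IsEuclideanDiagram : ℕ → Multiset (Sym2 ℕ) → Prop
  /-- The cycle `0 - 1 - ⋯ - n - 0` (a double edge if `n = 1`). -/
  | A (n : ℕ) (hn : 1 ≤ n) :
      IsEuclideanDiagram (n + 1)
        (s(n, 0) ::ₘ (Finset.range n).val.map fun i => s(i, i + 1))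
  /-- The path `1 - 2 - ⋯ - (n - 1)` with the extra edges `0 - 2` and `(n - 2) - n`. -/
  | D (n : ℕ) (hn : 4 ≤ n) :
      IsEuclideanDiagram (n + 1)
        (s(0, 2) ::ₘ s(n - 2, n) ::ₘ (Finset.Icc 1 (n - 2)).val.map fun i => s(i, i + 1))
  /-- The star with three arms of two vertices each around the vertex `2`. -/
  | E6 : IsEuclideanDiagram 7
      {s(0, 1), s(1, 2), s(2, 3), s(3, 4), s(2, 5), s(5, 6)}
  /-- The star with arms of three, three and one vertices around the vertex `3`. -/
  | E7 : IsEuclideanDiagram 8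
      {s(0, 1), s(1, 2), s(2, 3), s(3, 4), s(4, 5), s(5, 6), s(3, 7)}
  /-- The star with arms of two, five and one vertices around the vertex `2`. -/
  | E8 : IsEuclideanDiagram 9
      {s(0, 1), s(1, 2), s(2, 3), s(3, 4), s(4, 5), s(5, 6), s(6, 7), s(2, 8)}

/-- `Q` is a Euclidean quiver: its underlying multigraph is isomorphic to a Euclidean diagram
(such a quiver is in particular connected). -/
def IsEuclideanQuiver : Prop :=
  ∃ (N : ℕ) (E : Multiset (Sym2 ℕ)) (e : Q ≃ Fin N),
    IsEuclideanDiagram N E ∧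
      (underlyingEdges Q).map (Sym2.map fun x => (e x : ℕ)) = E

variable {Q}

/-- The Euler form `⟨α, β⟩ = ∑_x α(x) β(x) - ∑_a α(ta) β(ha)`. -/
def eulerForm (α β : Q → ℤ) : ℤ :=
  ∑ x, α x * β x - ∑ a : (Σ x y : Q, x ⟶ y), α a.1 * β a.2.1

end Quivers

/-! ### Representations -/

/-- The category `rep(Q)` of finite-dimensional representations of `Q` over `K`. A functor from
the category of paths of `Q` is the same as a choice of a vector space for each vertex and
a linear map for each arrow. -/
abbrev QuiverRep (K : Type u) [Field K] (Q : Type v) [Quiver.{w} Q] :=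
  Paths Q ⥤ FGModuleCat.{u} K

/-- The `Ext` groups of the abelian category `rep(Q)` are formed in the standard universe. -/
instance QuiverRep.hasExt (K : Type u) [Field K] (Q : Type v) [Quiver.{w} Q] :
    HasExt.{max (u + 1) v w} (QuiverRep K Q) :=
  HasExt.standard _

namespace QuiverRep

variable {K : Type u} [Field K] {Q : Type v} [Quiver.{w} Q]

/-- The dimension vector of `V`. -/
def dimVec (V : QuiverRep K Q) : Q → ℤ :=
  fun x => (Module.finrank K (V.obj ((Paths.of Q).obj x)) : ℤ)

/-- `V` is a Schur representation: `End_Q(V) ≃ K` as `K`-algebras. -/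
def IsSchur (V : QuiverRep K Q) : Prop :=
  Nonempty (End V ≃ₐ[K] K)

/-- `Hom_Q(V, W) = 0`. -/
def HomVanishes (V W : QuiverRep K Q) : Prop :=
  ∀ f : V ⟶ W, f = 0

/-- `Ext¹_Q(V, W) = 0`. -/
def ExtVanishes (V W : QuiverRep K Q) : Prop :=
  ∀ f : Abelian.Ext.{max (u + 1) v w} V W 1, f = 0

/-- `V` is exceptional: it is Schur and `Ext¹_Q(V, V) = 0`. -/
def IsExceptional (V : QuiverRep K Q) : Prop :=
  IsSchur V ∧ ExtVanishes V V

/-- `X` is (isomorphic to) a direct summand of `V`. -/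
def IsDirectSummand (X V : QuiverRep K Q) : Prop :=
  ∃ Y : QuiverRep K Q, Nonempty (V ≅ X ⊞ Y)

/-- An orthogonal Schur sequence: Schur representations that are mutually orthogonal. -/
def IsOrthogonalSchurSequence {r : ℕ} (V : Fin r → QuiverRep K Q) : Prop :=
  (∀ i, IsSchur (V i)) ∧ ∀ i j, i ≠ j → HomVanishes (V i) (V j)

/-- An exceptional sequence: exceptional representations with
`Hom_Q(V_i, V_j) = Ext¹_Q(V_i, V_j) = 0` for `i < j`. -/
def IsExceptionalSequence {r : ℕ} (V : Fin r → QuiverRep K Q) : Prop :=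
  (∀ i, IsExceptional (V i)) ∧
    ∀ i j, i < j → HomVanishes (V i) (V j) ∧ ExtVanishes (V i) (V j)

/-- An orthogonal exceptional sequence: an exceptional sequence whose members are
mutually orthogonal. -/
def IsOrthogonalExceptionalSequence {r : ℕ} (V : Fin r → QuiverRep K Q) : Prop :=
  IsExceptionalSequence V ∧ ∀ i j, i ≠ j → HomVanishes (V i) (V j)

variable [Fintype Q] [∀ x y : Q, Fintype (x ⟶ y)]

variable (K) in
/-- `δ` is an imaginary Schur root of `Q`: the dimension vector of a Schur representation, with
`q(δ) = ⟨δ, δ⟩ ≤ 0`. A Euclidean quiver has exactly one. -/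
def IsImaginarySchurRoot (δ : Q → ℤ) : Prop :=
  (∃ V : QuiverRep K Q, IsSchur V ∧ dimVec V = δ) ∧ eulerForm δ δ ≤ 0

/-- The defect `⟨δ, dim V⟩` of `V`. -/
def defect (δ : Q → ℤ) (V : QuiverRep K Q) : ℤ :=
  eulerForm δ (dimVec V)

/-- `V` is preprojective: all its indecomposable direct summands have negative defect. -/
def IsPreprojective (δ : Q → ℤ) (V : QuiverRep K Q) : Prop :=
  ∀ X : QuiverRep K Q, Indecomposable X → IsDirectSummand X V → defect δ X < 0

/-- `V` is preinjective: all its indecomposable direct summands have positive defect. -/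
def IsPreinjective (δ : Q → ℤ) (V : QuiverRep K Q) : Prop :=
  ∀ X : QuiverRep K Q, Indecomposable X → IsDirectSummand X V → 0 < defect δ X

end QuiverRep

end

/-!
The proof is numerical. For representations `V`, `W` the linear map
`⨁_x Hom(V_x, W_x) → ⨁_a Hom(V_{ta}, W_{ha})` (`QuiverRep.coboundary`) has kernel `Hom(V, W)`, and if
it is onto then every extension of `V` by `W` splits, so that `Ext¹(V, W) = 0`. Counting dimensions,
`⟨dim V, dim W⟩ ≤ dim Hom(V, W)`, and `Ext¹(V, W) = 0` in case of equality
(`QuiverRep.eulerForm_dimVec`, `QuiverRep.extVanishes_of_finrank_hom_le`). The passage from split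
sequences to the `Ext` groups of the derived category is
`CategoryTheory.Abelian.Ext.eq_zero_of_forall_splits`.

The quadratic form of a Euclidean quiver is positive semidefinite and its isotropic vectors lie on
a line (`IsEuclideanQuiver.exists_null_vector`), so two isotropic vectors pair to zero under the
Euler form. Hence `δ` is isotropic, and every isotropic dimension vector has defect zero.

Let `d_i` be the dimension vectors of the `V_i`. As the `V_i` are indecomposable, their defects are
nonzero and of the same sign. So `⟨d_i, d_i⟩ > 0`, and since `dim End V_i = 1` this forces
`⟨d_i, d_i⟩ = 1` and `Ext¹(V_i, V_i) = 0`. For `i ≠ j` orthogonality gives `⟨d_i, d_j⟩ ≤ 0`. If in some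
nonempty set `S` of indices every `i` had a `j ≠ i` with `⟨d_i, d_j⟩ < 0`, then
`⟨∑_S d_i, ∑_S d_i⟩ ≤ 0`, so `∑_S d_i` would be isotropic and have defect zero, which contradicts
the signs (`IsEuclideanQuiver.exists_forall_eulerForm_eq_zero`). Thus every such `S` contains an `i`
with `⟨d_i, d_j⟩ = 0`, hence `Ext¹(V_i, V_j) = 0`, for all other `j ∈ S`; putting such an `i` first
and repeating gives the permutation.
-/

/-! ### Vanishing of `Ext¹` from splitting of short exact sequences -/

section ExtOne

universe w' u' v'

variable {C : Type u'} [Category.{v'} C] [Abelian C]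

theorem CochainComplex.epi_f_zero_of_quasiIso_single {X : C} {L : CochainComplex C ℤ}
    [L.IsStrictlyLE 0]
    (s : L ⟶ (HomologicalComplex.single C (ComplexShape.up ℤ) 0).obj X) [QuasiIsoAt s 0] :
    Epi (s.f 0) := by
  have h1 : IsIso (HomologicalComplex.homologyMap s 0) := inferInstance
  have h2 : Epi (HomologicalComplex.cyclesMap s 0) := by
    have h3 : Epi (HomologicalComplex.cyclesMap s 0 ≫
      HomologicalComplex.homologyπ _ 0) := by
      rw [← HomologicalComplex.homologyπ_naturality]
      infer_instance
    have h4 : IsIso (((HomologicalComplex.single C (ComplexShape.up ℤ) 0).obj X).homologyπ 0) :=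
      HomologicalComplex.isIso_homologyπ _ (-1) 0 (by simp) (by
        apply (HomologicalComplex.isZero_single_obj_X (ComplexShape.up ℤ) 0 X (-1)
          (by lia)).eq_of_src)
    rw [← (Category.comp_id (HomologicalComplex.cyclesMap s 0)),
      ← IsIso.hom_inv_id (((HomologicalComplex.single C (ComplexShape.up ℤ) 0).obj X).homologyπ 0),
      ← Category.assoc]
    infer_instance
  have h5 : IsIso (((HomologicalComplex.single C (ComplexShape.up ℤ) 0).obj X).iCycles 0) :=
    HomologicalComplex.isIso_iCycles _ 0 1 (by simp) (by
      apply (HomologicalComplex.isZero_single_obj_X (ComplexShape.up ℤ) 0 X 1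
        (by lia)).eq_of_tgt)
  have h6 : Epi (L.iCycles 0 ≫ s.f 0) := by
    rw [← HomologicalComplex.cyclesMap_i]
    infer_instance
  exact epi_of_epi (L.iCycles 0) _

open DerivedCategory in
/-- Classes in `Ext¹` are weakly effaceable: represent the class `X ⟶ Y[1]` of the derived category
by a roof `X ← L → Y[1]` with `L` in degrees `≤ 0`. Then `L⁰ ⟶ X` is an epimorphism, and the class
vanishes on `L⁰` because a chain map `L⁰[0] ⟶ L ⟶ Y[1]` is zero for degree reasons. -/
theorem CategoryTheory.Abelian.Ext.exists_epi_comp_eq_zero [HasExt.{w'} C] {X Y : C}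
    (e : Abelian.Ext.{w'} X Y 1) :
    ∃ (P : C) (p : P ⟶ X), Epi p ∧ (Abelian.Ext.mk₀ p).comp e (zero_add 1) = 0 := by
  let := HasDerivedCategory.standard C
  let φ : Q.obj ((HomologicalComplex.single C (ComplexShape.up ℤ) 0).obj X) ⟶
      Q.obj ((HomologicalComplex.single C (ComplexShape.up ℤ) (-1)).obj Y) :=
    e.hom ≫ ((singleFunctors C).shiftIso 1 (-1) 0 (by lia)).hom.app _
  obtain ⟨L, _, s, h, g, hg⟩ := right_fac_of_isStrictlyLE φ 0
  have := (isIso_Q_map_iff_quasiIso _ s).1 h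
  have := CochainComplex.epi_f_zero_of_quasiIso_single s
  let t : (HomologicalComplex.single C (ComplexShape.up ℤ) 0).obj (L.X 0) ⟶ L :=
    HomologicalComplex.mkHomFromSingle (𝟙 _) (by
      rintro i rfl
      apply (L.isZero_of_isStrictlyLE 0 (0 + 1) (by simp)).eq_of_tgt)
  let p : L.X 0 ⟶ X := s.f 0 ≫ (HomologicalComplex.singleObjXSelf (ComplexShape.up ℤ) 0 X).hom
  have htp : (HomologicalComplex.single C (ComplexShape.up ℤ) 0).map p = t ≫ s := by
    apply HomologicalComplex.from_single_hom_ext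
    simp [t, p, HomologicalComplex.single_map_f_self]
  have htg : t ≫ g = 0 := by
    apply HomologicalComplex.from_single_hom_ext
    apply (HomologicalComplex.isZero_single_obj_X (ComplexShape.up ℤ) (-1) Y 0
      (by lia)).eq_of_tgt
  refine ⟨L.X 0, p, epi_comp _ _, ?_⟩
  have key : Q.map ((HomologicalComplex.single C (ComplexShape.up ℤ) 0).map p) ≫ φ = 0 := by
    rw [hg, htp, Q.map_comp, Category.assoc, IsIso.hom_inv_id_assoc, ← Q.map_comp, htg,
      Q.map_zero]
  ext
  rw [Abelian.Ext.comp_hom, Abelian.Ext.mk₀_hom, Abelian.Ext.zero_hom, ShiftedHom.mk₀_comp]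
  simp only [← cancel_mono (((singleFunctors C).shiftIso 1 (-1) 0
    (by lia)).hom.app _), Limits.zero_comp, Category.assoc]
  exact key

/-- If all short exact sequences `0 ⟶ Y ⟶ E ⟶ X ⟶ 0` split, then `Ext¹(X, Y) = 0`: a class killed by
an epimorphism `p : P ⟶ X` is the pushout of the class of `0 ⟶ ker p ⟶ P ⟶ X ⟶ 0` along some
`ker p ⟶ Y`, hence it is the class of a short exact sequence. -/
theorem CategoryTheory.Abelian.Ext.eq_zero_of_forall_splits [HasExt.{w'} C] {X Y : C}
    (h : ∀ (E : C) (f : Y ⟶ E) (g : E ⟶ X) (w : f ≫ g = 0),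
      (ShortComplex.mk f g w).ShortExact → ∃ s : X ⟶ E, s ≫ g = 𝟙 X)
    (e : Abelian.Ext.{w'} X Y 1) : e = 0 := by
  obtain ⟨P, p, hp, hpe⟩ := e.exists_epi_comp_eq_zero
  let S := ShortComplex.mk _ _ (kernel.condition p)
  have hS : S.ShortExact := { exact := ShortComplex.exact_kernel p }
  obtain ⟨x, hx⟩ := Abelian.Ext.contravariant_sequence_exact₃ hS _ e hpe (add_zero 1)
  obtain ⟨k, rfl⟩ := (Abelian.Ext.mk₀_bijective _ _).2 x
  let g : pushout k (kernel.ι p) ⟶ X := pushout.desc 0 p (by simp [S])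
  have hg : pushout.inr k (kernel.ι p) ≫ g = p := pushout.inr_desc _ _ _
  have hg0 : pushout.inl k (kernel.ι p) ≫ g = 0 := pushout.inl_desc _ _ _
  let S' := ShortComplex.mk (pushout.inl k (kernel.ι p)) g hg0
  have hepi : Epi g := by
    rw [← hg] at hp
    exact epi_of_epi (pushout.inr k (kernel.ι p)) g
  have hS' : S'.ShortExact :=
    { exact := by
        apply ShortComplex.exact_of_g_is_cokernel
        refine CokernelCofork.IsColimit.ofπ' _ _ fun {T} t ht => ?_
        have h1 : kernel.ι p ≫ pushout.inr k (kernel.ι p) ≫ t = 0 := by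
          rw [← pushout.condition_assoc]
          exact (congrArg (k ≫ ·) ht).trans (by simp)
        refine ⟨hS.exact.desc _ h1, ?_⟩
        apply pushout.hom_ext
        · change S'.f ≫ S'.g ≫ _ = S'.f ≫ t
          rw [S'.zero_assoc, ht]
          exact Limits.zero_comp
        · change pushout.inr k (kernel.ι p) ≫ g ≫ _ = _
          rw [reassoc_of% hg]
          exact hS.exact.g_desc _ h1
      mono_f := by dsimp [S']; infer_instance
      epi_g := hepi }
  let m : S ⟶ S' :=
    { τ₁ := k
      τ₂ := pushout.inr k (kernel.ι p)
      τ₃ := 𝟙 X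
      comm₁₂ := pushout.condition
      comm₂₃ := by simp [S, S', hg] }
  obtain ⟨s, hs⟩ := h _ _ _ _ hS'
  have h2 := ShortComplex.ShortExact.extClass_naturality hS hS' m
  rw [← hx]
  refine h2.trans ?_
  have h3 : hS'.extClass = 0 := by
    rw [← Abelian.Ext.mk₀_id_comp hS'.extClass, ← hs, ← Abelian.Ext.mk₀_comp_mk₀_assoc,
      hS'.comp_extClass, Abelian.Ext.comp_zero]
  rw [h3, Abelian.Ext.comp_zero]

end ExtOne

/-! ### Homomorphisms, extensions and the Euler form -/

/-- Morphisms of `FGModuleCat K` are the linear maps. -/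
def FGModuleCat.homLinearEquiv {K : Type u} [Field K] (A B : FGModuleCat.{u} K) :
    (A ⟶ B) ≃ₗ[K] (A →ₗ[K] B) where
  toFun f := f.hom.hom
  map_add' _ _ := rfl
  map_smul' _ _ := rfl
  invFun f := FGModuleCat.ofHom f
  left_inv _ := rfl
  right_inv _ := rfl

namespace QuiverRep

section Coboundary

variable {K : Type u} [Field K] {Q : Type v} [Quiver.{w} Q]

/-- The linear map `⨁_x Hom(V_x, W_x) → ⨁_a Hom(V_{ta}, W_{ha})` sending `(φ_x)` to
`(φ_{ha} V_a - W_a φ_{ta})`. -/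
noncomputable def coboundary (V W : QuiverRep K Q) :
    (∀ x : Q, V.obj ((Paths.of Q).obj x) ⟶ W.obj ((Paths.of Q).obj x)) →ₗ[K]
      (∀ a : Σ x y : Q, x ⟶ y,
        V.obj ((Paths.of Q).obj a.1) ⟶ W.obj ((Paths.of Q).obj a.2.1)) where
  toFun φ a := V.map ((Paths.of Q).map a.2.2) ≫ φ a.2.1 - φ a.1 ≫ W.map ((Paths.of Q).map a.2.2)
  map_add' φ ψ := by
    funext a
    simp only [Pi.add_apply, Preadditive.comp_add, Preadditive.add_comp]
    abel
  map_smul' c φ := by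
    funext a
    simp only [Pi.smul_apply, Linear.comp_smul, Linear.smul_comp, RingHom.id_apply, smul_sub]

theorem coboundary_apply (V W : QuiverRep K Q)
    (φ : ∀ x : Q, V.obj ((Paths.of Q).obj x) ⟶ W.obj ((Paths.of Q).obj x))
    (a : Σ x y : Q, x ⟶ y) :
    coboundary V W φ a = V.map ((Paths.of Q).map a.2.2) ≫ φ a.2.1 -
      φ a.1 ≫ W.map ((Paths.of Q).map a.2.2) := rfl

/-- The homomorphisms `V ⟶ W` are the kernel of the coboundary map. -/
noncomputable def homEquivKerCoboundary (V W : QuiverRep K Q) :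
    (V ⟶ W) ≃ₗ[K] LinearMap.ker (coboundary V W) where
  toFun f := ⟨fun x => f.app ((Paths.of Q).obj x), by
    rw [LinearMap.mem_ker]
    funext a
    rw [coboundary_apply, f.naturality, sub_self]
    rfl⟩
  map_add' f g := rfl
  map_smul' c f := rfl
  invFun φ := Paths.liftNatTrans φ.1 fun {x y} a =>
    sub_eq_zero.1 (congrFun (LinearMap.mem_ker.1 φ.2) ⟨x, y, a⟩)
  left_inv f := rfl
  right_inv φ := rfl

/-- Choose linear sections `s_x : V_x ⟶ E_x`. Their failure to commute with the arrows is a family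
`c_a : V_{ta} ⟶ W_{ha}`, and if `c` is the coboundary of `φ`, then `s + f φ` is a section in the
category of representations. -/
theorem exists_section_of_coboundary_surjective {V W : QuiverRep K Q}
    (h : Function.Surjective (coboundary V W)) (E : QuiverRep K Q) (f : W ⟶ E) (g : E ⟶ V)
    (w : f ≫ g = 0) (hS : (ShortComplex.mk f g w).ShortExact) : ∃ s : V ⟶ E, s ≫ g = 𝟙 V := by
  have hex : ∀ x : Paths Q, ((ShortComplex.mk f g w).map
      ((evaluation (Paths Q) (FGModuleCat K)).obj x)).ShortExact := fun x =>
    hS.map_of_exact _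
  have hsec : ∀ x : Paths Q, ∃ s : V.obj x ⟶ E.obj x, s ≫ g.app x = 𝟙 _ := by
    intro x
    have hepi : Epi (g.app x) := (hex x).epi_g
    have hsurj : Function.Surjective (g.app x).hom.hom := by
      have : Epi ((forget₂ (FGModuleCat K) (ModuleCat K)).map (g.app x)) := inferInstance
      exact (ModuleCat.epi_iff_surjective _).1 this
    obtain ⟨s, hs⟩ := LinearMap.exists_rightInverse_of_surjective _ (LinearMap.range_eq_top.2 hsurj)
    exact ⟨FGModuleCat.ofHom s, FGModuleCat.hom_ext hs⟩
  choose s hs using hsec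
  have hlift : ∀ a : Σ x y : Q, x ⟶ y,
      ∃ c : V.obj ((Paths.of Q).obj a.1) ⟶ W.obj ((Paths.of Q).obj a.2.1),
        c ≫ f.app _ = s _ ≫ E.map ((Paths.of Q).map a.2.2) -
          V.map ((Paths.of Q).map a.2.2) ≫ s _ := by
    intro a
    have := (hex ((Paths.of Q).obj a.2.1)).mono_f
    refine ⟨(hex _).exact.lift (s _ ≫ E.map ((Paths.of Q).map a.2.2) -
          V.map ((Paths.of Q).map a.2.2) ≫ s _) ?_, (hex _).exact.lift_f _ _⟩
    change (_ - _) ≫ g.app _ = 0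
    rw [Preadditive.sub_comp, Category.assoc, Category.assoc, hs, g.naturality,
      reassoc_of% hs, Category.comp_id, sub_self]
  choose c hc using hlift
  obtain ⟨φ, hφ⟩ := h c
  refine ⟨Paths.liftNatTrans (fun x => s ((Paths.of Q).obj x) + φ x ≫ f.app ((Paths.of Q).obj x))
    ?_, ?_⟩
  · intro x y a
    change V.map ((Paths.of Q).map a) ≫ _ = _ ≫ E.map ((Paths.of Q).map a)
    have h1 := hc ⟨x, y, a⟩
    rw [← hφ, coboundary_apply] at h1
    simp only [Preadditive.sub_comp, Preadditive.comp_add, Preadditive.add_comp,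
      Category.assoc, f.naturality] at h1 ⊢
    rw [sub_eq_sub_iff_add_eq_add] at h1
    rw [add_comm, h1]
  · ext x : 2
    have hw : f.app x ≫ g.app x = 0 := by rw [← NatTrans.comp_app, w]; rfl
    let t : V.obj x ⟶ W.obj x := φ x
    change (s x + t ≫ f.app x) ≫ g.app x = 𝟙 (V.obj x)
    rw [Preadditive.add_comp, hs, Category.assoc, hw, comp_zero, add_zero]

theorem extVanishes_of_coboundary_surjective {V W : QuiverRep K Q}
    (h : Function.Surjective (coboundary V W)) : ExtVanishes V W :=
  Abelian.Ext.eq_zero_of_forall_splits (exists_section_of_coboundary_surjective h)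

end Coboundary

section Euler

variable {K : Type u} [Field K] {Q : Type v} [Quiver.{w} Q]

variable [Fintype Q] [∀ x y : Q, Fintype (x ⟶ y)]

/-- `⟨dim V, dim W⟩ = dim Hom(V, W) - dim coker`, where `coker` is the cokernel of the coboundary
map. -/
theorem eulerForm_dimVec (V W : QuiverRep K Q) :
    eulerForm (dimVec V) (dimVec W) = Module.finrank K (V ⟶ W) -
      (Module.finrank K ((∀ a : Σ x y : Q, x ⟶ y,
        V.obj ((Paths.of Q).obj a.1) ⟶ W.obj ((Paths.of Q).obj a.2.1)) ⧸
          LinearMap.range (coboundary V W)) : ℤ) := by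
  have hdim : ∀ A B : FGModuleCat.{u} K,
      Module.finrank K (A ⟶ B) = Module.finrank K A * Module.finrank K B := fun A B => by
    rw [(FGModuleCat.homLinearEquiv A B).finrank_eq, Module.finrank_linearMap]
  have h1 := (coboundary V W).finrank_range_add_finrank_ker
  have h2 := (LinearMap.range (coboundary V W)).finrank_quotient_add_finrank
  rw [← (homEquivKerCoboundary V W).finrank_eq] at h1
  rw [Module.finrank_pi_fintype] at h1 h2
  simp only [hdim] at h1 h2
  unfold eulerForm dimVec
  zify at h1 h2
  linarith

/-- The Euler form never exceeds `dim Hom(V, W)`; where it reaches this bound the coboundary map is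
onto and `Ext¹(V, W) = 0`. -/
theorem extVanishes_of_finrank_hom_le {V W : QuiverRep K Q}
    (h : (Module.finrank K (V ⟶ W) : ℤ) ≤ eulerForm (dimVec V) (dimVec W)) :
    ExtVanishes V W := by
  rw [eulerForm_dimVec] at h
  apply extVanishes_of_coboundary_surjective
  rw [← LinearMap.range_eq_top, ← Submodule.Quotient.subsingleton_iff,
    ← Module.finrank_zero_iff (R := K)]
  lia

end Euler

end QuiverRep

/-! ### The quadratic forms of the Euclidean diagrams -/

section Diagrams

/-- `n` is a null weight of the multigraph with vertices `0, …, N - 1` and edges `E`: it is positive,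
twice its value at any vertex is the sum of its values at the neighbours (with multiplicity), and
the graph is connected. The harmonicity is stated after pairing with an arbitrary function `f`, and
connectedness as: functions constant along edges are constant. -/
structure IsNullWeight (N : ℕ) (E : Multiset (Sym2 ℕ)) (n : ℕ → ℚ) : Prop where
  pos : ∀ i, 0 < n i
  harmonic : ∀ f : ℕ → ℚ,
    (E.map (Sym2.lift ⟨fun i j => n j * f i + n i * f j, fun _ _ => add_comm _ _⟩)).sum =
      2 * ∑ i ∈ Finset.range N, n i * f i
  eq_of_edges : ∀ b : ℕ → ℚ, (∀ i j, s(i, j) ∈ E → b i = b j) → ∀ i < N, b i = b 0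

theorem isNullWeight_A (n : ℕ) :
    IsNullWeight (n + 1) (s(n, 0) ::ₘ (Finset.range n).val.map fun i => s(i, i + 1))
      fun _ => 1 where
  pos _ := one_pos
  harmonic f := by
    have h : ((Finset.range n).val.map fun i => f i + f (i + 1)).sum =
        ∑ i ∈ Finset.range n, (f i + f (i + 1)) := rfl
    simp only [Multiset.map_cons, Multiset.sum_cons, Multiset.map_map, Function.comp_def,
      Sym2.lift_mk, one_mul, h]
    rw [Finset.sum_add_distrib]
    have h1 := Finset.sum_range_succ f n
    have h2 := Finset.sum_range_succ' f n
    linarith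
  eq_of_edges b hb i hi := by
    induction i with
    | zero => rfl
    | succ i ih =>
      rw [← ih (by lia)]
      refine (hb i (i + 1) (Multiset.mem_cons_of_mem (Multiset.mem_map.2 ⟨i, ?_, rfl⟩))).symm
      simpa using hi

/-- The null weight of `D̃_{m+4}`: it is `1` at the four leaves `0`, `1`, `m + 3`, `m + 4` and `2`
at the inner vertices. -/
def weightD (m i : ℕ) : ℚ := if 2 ≤ i ∧ i ≤ m + 2 then 2 else 1

theorem isNullWeight_D (m : ℕ) :
    IsNullWeight (m + 5) (s(0, 2) ::ₘ s(m + 2, m + 4) ::ₘ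
        (Finset.Icc 1 (m + 2)).val.map fun i => s(i, i + 1))
      (weightD m) where
  pos i := by
    unfold weightD
    split_ifs <;> norm_num
  harmonic f := by
    set n := weightD m with hn
    have h : ((Finset.Icc 1 (m + 2)).val.map fun i => n (i + 1) * f i + n i * f (i + 1)).sum =
        ∑ i ∈ Finset.Ico 1 (m + 3), (n (i + 1) * f i + n i * f (i + 1)) := rfl
    simp only [Multiset.map_cons, Multiset.sum_cons, Multiset.map_map, Function.comp_def,
      Sym2.lift_mk, h]
    have n0 : n 0 = 1 := by simp [hn, weightD]
    have n1 : n 1 = 1 := by simp [hn, weightD]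
    have n2 : ∀ i ≤ m, n (i + 2) = 2 := fun i hi => by simp [hn, weightD, hi]
    have n3 : n (m + 3) = 1 := by simp [hn, weightD]
    have n4 : n (m + 4) = 1 := by simp [hn, weightD]
    have hE : ∑ i ∈ Finset.range m,
        (n (i + 3) * f (i + 2) + n (i + 2) * f (i + 3)) =
        ∑ i ∈ Finset.range m, (2 * f (i + 2) + 2 * f (i + 3)) :=
      Finset.sum_congr rfl fun i hi => by
        have := Finset.mem_range.1 hi
        rw [n2 i (by lia), n2 (i + 1) (by lia)]
    have hV : ∑ i ∈ Finset.range (m + 1), n (i + 2) * f (i + 2) =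
        ∑ i ∈ Finset.range (m + 1), 2 * f (i + 2) :=
      Finset.sum_congr rfl fun i hi => by
        have := Finset.mem_range.1 hi
        rw [n2 i (by lia)]
    have h1 := Finset.sum_range_succ (fun i => f (i + 2)) m
    have h2 := Finset.sum_range_succ' (fun i => f (i + 2)) m
    rw [Finset.sum_Ico_eq_sum_range, show m + 3 - 1 = m + 1 + 1 from rfl]
    simp only [add_comm 1]
    rw [Finset.sum_range_succ' _ (m + 1), Finset.sum_range_succ _ m, Finset.sum_range_succ,
      Finset.sum_range_succ, Finset.sum_range_succ', Finset.sum_range_succ']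
    simp only [add_assoc, Nat.reduceAdd, zero_add] at *
    rw [hE, hV, n0, n1, n3, n4, n2 0 (by lia), n2 m le_rfl, Finset.sum_add_distrib,
      ← Finset.mul_sum, ← Finset.mul_sum, ← Finset.mul_sum]
    linarith
  eq_of_edges b hb := by
    have h0 : b 0 = b 2 := hb 0 2 (by simp)
    have hs : ∀ i, 1 ≤ i → i ≤ m + 2 → b i = b (i + 1) := fun i h1 h2 =>
      hb i (i + 1) (Multiset.mem_cons_of_mem (Multiset.mem_cons_of_mem
        (Multiset.mem_map.2 ⟨i, by simpa using ⟨h1, h2⟩, rfl⟩)))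
    have h4 : b (m + 2) = b (m + 4) := hb _ _ (by simp)
    have hp : ∀ i, i ≤ m + 2 → b (i + 1) = b 0 := by
      intro i hi
      induction i with
      | zero => rw [h0, hs 1 le_rfl (by lia)]
      | succ i ih => rw [← hs (i + 1) (by lia) hi, ih (by lia)]
    rintro (_ | i) hi
    · rfl
    · obtain rfl | h : i = m + 3 ∨ i ≤ m + 2 := by lia
      · rw [← h4, hp (m + 1) (by lia)]
      · exact hp i h

theorem isNullWeight_E6 :
    IsNullWeight 7 {s(0, 1), s(1, 2), s(2, 3), s(3, 4), s(2, 5), s(5, 6)}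
      fun i => [1, 2, 3, 2, 1, 2, 1].getD i 1 where
  pos i := by
    rcases lt_or_ge i 7 with h | h
    · interval_cases i <;> simp
    · rw [List.getD_eq_default _ _ (by simpa using h)]
      exact one_pos
  harmonic f := by
    simp [Finset.sum_range_succ]
    ring
  eq_of_edges b hb i hi := by
    have h01 : b 0 = b 1 := hb 0 1 (by simp)
    have h12 : b 1 = b 2 := hb 1 2 (by simp)
    have h23 : b 2 = b 3 := hb 2 3 (by simp)
    have h34 : b 3 = b 4 := hb 3 4 (by simp)
    have h25 : b 2 = b 5 := hb 2 5 (by simp)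
    have h56 : b 5 = b 6 := hb 5 6 (by simp)
    interval_cases i <;> linarith

theorem isNullWeight_E7 :
    IsNullWeight 8 {s(0, 1), s(1, 2), s(2, 3), s(3, 4), s(4, 5), s(5, 6), s(3, 7)}
      fun i => [1, 2, 3, 4, 3, 2, 1, 2].getD i 1 where
  pos i := by
    rcases lt_or_ge i 8 with h | h
    · interval_cases i <;> simp
    · rw [List.getD_eq_default _ _ (by simpa using h)]
      exact one_pos
  harmonic f := by
    simp [Finset.sum_range_succ]
    ring
  eq_of_edges b hb i hi := by
    have h01 : b 0 = b 1 := hb 0 1 (by simp)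
    have h12 : b 1 = b 2 := hb 1 2 (by simp)
    have h23 : b 2 = b 3 := hb 2 3 (by simp)
    have h34 : b 3 = b 4 := hb 3 4 (by simp)
    have h45 : b 4 = b 5 := hb 4 5 (by simp)
    have h56 : b 5 = b 6 := hb 5 6 (by simp)
    have h37 : b 3 = b 7 := hb 3 7 (by simp)
    interval_cases i <;> linarith

theorem isNullWeight_E8 :
    IsNullWeight 9 {s(0, 1), s(1, 2), s(2, 3), s(3, 4), s(4, 5), s(5, 6), s(6, 7), s(2, 8)}
      fun i => [2, 4, 6, 5, 4, 3, 2, 1, 3].getD i 1 where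
  pos i := by
    rcases lt_or_ge i 9 with h | h
    · interval_cases i <;> simp
    · rw [List.getD_eq_default _ _ (by simpa using h)]
      exact one_pos
  harmonic f := by
    simp [Finset.sum_range_succ]
    ring
  eq_of_edges b hb i hi := by
    have h01 : b 0 = b 1 := hb 0 1 (by simp)
    have h12 : b 1 = b 2 := hb 1 2 (by simp)
    have h23 : b 2 = b 3 := hb 2 3 (by simp)
    have h34 : b 3 = b 4 := hb 3 4 (by simp)
    have h45 : b 4 = b 5 := hb 4 5 (by simp)
    have h56 : b 5 = b 6 := hb 5 6 (by simp)
    have h67 : b 6 = b 7 := hb 6 7 (by simp)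
    have h28 : b 2 = b 8 := hb 2 8 (by simp)
    interval_cases i <;> linarith

theorem IsEuclideanDiagram.exists_isNullWeight {N : ℕ} {E : Multiset (Sym2 ℕ)}
    (h : IsEuclideanDiagram N E) : ∃ n, IsNullWeight N E n := by
  cases h with
  | A n _ => exact ⟨_, isNullWeight_A n⟩
  | D n hn =>
    obtain ⟨m, rfl⟩ := Nat.exists_eq_add_of_le' hn
    exact ⟨_, isNullWeight_D m⟩
  | E6 => exact ⟨_, isNullWeight_E6⟩
  | E7 => exact ⟨_, isNullWeight_E7⟩
  | E8 => exact ⟨_, isNullWeight_E8⟩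

/-- A null weight `n` makes the quadratic form a sum of squares: for `a = n b`, twice its value at `a`
is `∑ n_i n_j (b_i - b_j)²`, the sum being over the edges. -/
theorem IsNullWeight.two_mul_form_eq {N : ℕ} {E : Multiset (Sym2 ℕ)} {n : ℕ → ℚ}
    (h : IsNullWeight N E n) (b : ℕ → ℚ) :
    2 * (∑ i ∈ Finset.range N, (n i * b i) * (n i * b i) -
        (E.map fun s => (s.map fun i => n i * b i).mul).sum) =
      (E.map (Sym2.lift ⟨fun i j => n i * n j * (b i - b j) ^ 2, fun _ _ => by ring⟩)).sum := by
  have h1 := h.harmonic fun i => n i * b i ^ 2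
  rw [mul_sub, ← Multiset.sum_map_mul_left, show ∑ i ∈ Finset.range N, (n i * b i) * (n i * b i) =
    ∑ i ∈ Finset.range N, n i * (n i * b i ^ 2) from Finset.sum_congr rfl fun i _ => by ring,
    ← h1, sub_eq_iff_eq_add, ← Multiset.sum_map_add]
  congr 1
  refine Multiset.map_congr rfl fun s _ => ?_
  induction s with
  | _ i j =>
    simp only [Sym2.lift_mk, Sym2.map_mk, Sym2.mul_mk]
    ring

end Diagrams

/-! ### The Euler form of a Euclidean quiver -/

section EuclideanForm

variable {Q : Type v} [Quiver.{w} Q] [Fintype Q] [∀ x y : Q, Fintype (x ⟶ y)]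

theorem eulerForm_self_eq (α : Q → ℤ) {N : ℕ} (e : Q ≃ Fin N) (a : ℕ → ℚ)
    (ha : ∀ x, (α x : ℚ) = a (e x)) :
    (eulerForm α α : ℚ) = ∑ i ∈ Finset.range N, a i * a i -
      (((underlyingEdges Q).map (Sym2.map fun x => (e x : ℕ))).map
        fun s => (s.map a).mul).sum := by
  unfold eulerForm underlyingEdges
  push_cast
  congr 1
  · rw [← Fin.sum_univ_eq_sum_range (fun i => a i * a i), ← e.sum_comp]
    simp only [ha]
  · simp only [Multiset.map_map, Function.comp_def, Sym2.map_mk, Sym2.mul_mk, ← ha]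
    rfl

/-- The Euler form is positive semidefinite, and its isotropic vectors lie on a line. -/
theorem IsEuclideanQuiver.exists_null_vector (hQ : IsEuclideanQuiver Q) :
    ∃ ν : Q → ℚ, ∀ α : Q → ℤ, 0 ≤ eulerForm α α ∧
      (eulerForm α α = 0 → ∃ c : ℚ, ∀ x, (α x : ℚ) = c * ν x) := by
  obtain ⟨N, E, e, hE, he⟩ := hQ
  obtain ⟨n, hn⟩ := hE.exists_isNullWeight
  refine ⟨fun x => n (e x), fun α => ?_⟩
  -- `b` is the quotient of `α` by the weight; its value outside `0, …, N - 1` is irrelevant.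
  let b : ℕ → ℚ := fun i => if h : i < N then α (e.symm ⟨i, h⟩) / n i else 0
  have hb : ∀ x, (α x : ℚ) = n (e x) * b (e x) := fun x => by
    have := (hn.pos (e x)).ne'
    simp only [b, Fin.is_lt, dif_pos, Fin.eta, Equiv.symm_apply_apply]
    field_simp
  have hq := eulerForm_self_eq α e (fun i => n i * b i) hb
  rw [he] at hq
  have h2 := hn.two_mul_form_eq b
  rw [← hq] at h2
  have hterm : ∀ y ∈ E.map (Sym2.lift ⟨fun i j => n i * n j * (b i - b j) ^ 2, fun _ _ => by ring⟩),
      0 ≤ y := by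
    intro y hy
    obtain ⟨s, -, rfl⟩ := Multiset.mem_map.1 hy
    induction s with
    | _ i j => exact mul_nonneg (mul_pos (hn.pos i) (hn.pos j)).le (sq_nonneg _)
  refine ⟨?_, fun h0 => ⟨b 0, fun x => ?_⟩⟩
  · have := Multiset.sum_nonneg hterm
    rw [← h2] at this
    exact_mod_cast nonneg_of_mul_nonneg_right this two_pos
  · rw [h0, Int.cast_zero, mul_zero, eq_comm] at h2
    rw [hb x, mul_comm]
    congr 1
    refine hn.eq_of_edges b (fun i j hij => ?_) _ (e x).is_lt
    have h3 : n i * n j * (b i - b j) ^ 2 = 0 :=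
      Multiset.all_zero_of_le_zero_le_of_sum_eq_zero hterm h2 _
        (Multiset.mem_map.2 ⟨s(i, j), hij, rfl⟩)
    have := mul_pos (hn.pos i) (hn.pos j)
    simpa [this.ne', sub_eq_zero] using h3

theorem IsEuclideanQuiver.eulerForm_nonneg (hQ : IsEuclideanQuiver Q) (α : Q → ℤ) :
    0 ≤ eulerForm α α := by
  obtain ⟨ν, hν⟩ := hQ.exists_null_vector
  exact (hν α).1

/-- The Euler form is not symmetric, so this does not follow from semidefiniteness alone; it holds
because `α` and `β` are multiples of the same vector. -/
theorem IsEuclideanQuiver.eulerForm_eq_zero_of_isotropic (hQ : IsEuclideanQuiver Q)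
    {α β : Q → ℤ} (hα : eulerForm α α = 0) (hβ : eulerForm β β = 0) : eulerForm α β = 0 := by
  obtain ⟨ν, hν⟩ := hQ.exists_null_vector
  obtain ⟨c, hc⟩ := (hν α).2 hα
  obtain ⟨d, hd⟩ := (hν β).2 hβ
  let q : ℚ := ∑ x, ν x * ν x - ∑ a : (Σ x y : Q, x ⟶ y), ν a.1 * ν a.2.1
  have key : ∀ (γ ε : Q → ℤ) (r s : ℚ), (∀ x, (γ x : ℚ) = r * ν x) → (∀ x, (ε x : ℚ) = s * ν x) →
      (eulerForm γ ε : ℚ) = r * s * q := by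
    intro γ ε r s hr hs
    simp only [eulerForm, q]
    push_cast
    simp only [hr, hs, mul_sub, Finset.mul_sum]
    congr 1 <;> exact Finset.sum_congr rfl fun _ _ => by ring
  have h1 := key α α c c hc hc
  have h2 := key α β c d hc hd
  rw [hα, Int.cast_zero, eq_comm] at h1
  have h3 : (eulerForm α β : ℚ) = 0 := by
    rw [h2]
    rcases mul_eq_zero.1 h1 with h | h
    · simp [mul_self_eq_zero.1 h]
    · simp [h]
  exact_mod_cast h3

end EuclideanForm

/-! ### Ordering a finite family -/

section Ordering

/-- The list is built by repeatedly splitting off an element related to all the remaining ones. -/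
theorem exists_nodup_list_pairwise {α : Type*} [DecidableEq α] {R : α → α → Prop}
    (h : ∀ S : Finset α, S.Nonempty → ∃ i ∈ S, ∀ j ∈ S, j ≠ i → R i j) (S : Finset α) :
    ∃ l : List α, l.Nodup ∧ (∀ x, x ∈ l ↔ x ∈ S) ∧ l.Pairwise R := by
  induction S using Finset.strongInduction with
  | H S ih =>
    rcases S.eq_empty_or_nonempty with rfl | hS
    · exact ⟨[], by simp⟩
    obtain ⟨i, hi, hR⟩ := h S hS
    obtain ⟨l, hnd, hmem, hpw⟩ := ih _ (Finset.erase_ssubset hi)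
    refine ⟨i :: l, ?_, ?_, ?_⟩
    · simp [hnd, hmem]
    · intro x
      by_cases hx : x = i <;> simp [hmem, hx, hi]
    · refine List.pairwise_cons.2 ⟨fun j hj => ?_, hpw⟩
      have := Finset.mem_erase.1 ((hmem j).1 hj)
      exact hR j this.2 this.1

theorem exists_perm_forall_lt {r : ℕ} {R : Fin r → Fin r → Prop}
    (h : ∀ S : Finset (Fin r), S.Nonempty → ∃ i ∈ S, ∀ j ∈ S, j ≠ i → R i j) :
    ∃ σ : Equiv.Perm (Fin r), ∀ i j, i < j → R (σ i) (σ j) := by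
  obtain ⟨l, hnd, hmem, hpw⟩ := exists_nodup_list_pairwise h Finset.univ
  let e := hnd.getEquivOfForallMemList l (fun x => (hmem x).2 (Finset.mem_univ x))
  have hl : r = l.length := by simpa using (Fintype.card_congr e).symm
  exact ⟨(finCongr hl).trans e, fun i j hij => List.pairwise_iff_get.1 hpw _ _ hij⟩

end Ordering

/-! ### Sources in an orthogonal family of real roots -/

section EulerForm

variable {Q : Type v} [Quiver.{w} Q] [Fintype Q] [∀ x y : Q, Fintype (x ⟶ y)]

theorem eulerForm_sum_right {ι : Type*} (S : Finset ι) (α : Q → ℤ) (d : ι → Q → ℤ) :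
    eulerForm α (∑ j ∈ S, d j) = ∑ j ∈ S, eulerForm α (d j) := by
  simp only [eulerForm, Finset.sum_apply, Finset.mul_sum, Finset.sum_sub_distrib]
  rw [Finset.sum_comm, Finset.sum_comm (s := S) (t := Finset.univ)]
  congr 1
  exact Finset.sum_comm

theorem eulerForm_sum_left {ι : Type*} (S : Finset ι) (d : ι → Q → ℤ) (β : Q → ℤ) :
    eulerForm (∑ i ∈ S, d i) β = ∑ i ∈ S, eulerForm (d i) β := by
  simp only [eulerForm, Finset.sum_apply, Finset.sum_mul, Finset.sum_sub_distrib]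
  rw [Finset.sum_comm, Finset.sum_comm (s := S) (t := Finset.univ)]
  congr 1
  exact Finset.sum_comm

/-- Some `i ∈ S` satisfies `⟨d i, d j⟩ = 0` for all other `j ∈ S`. Otherwise each row sum
`∑_j ⟨d i, d j⟩` is at most `1 - 1 = 0`, so `∑_{i ∈ S} d i` is isotropic, hence has defect zero,
although all its summands have defects of the same sign. -/
theorem IsEuclideanQuiver.exists_forall_eulerForm_eq_zero (hQ : IsEuclideanQuiver Q)
    {ι : Type*} {d : ι → Q → ℤ} (hdiag : ∀ i, eulerForm (d i) (d i) = 1)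
    (hoff : ∀ i j, i ≠ j → eulerForm (d i) (d j) ≤ 0)
    {δ : Q → ℤ} (hδ : eulerForm δ δ = 0)
    (hsign : (∀ i, eulerForm δ (d i) < 0) ∨ (∀ i, 0 < eulerForm δ (d i)))
    {S : Finset ι} (hS : S.Nonempty) :
    ∃ i ∈ S, ∀ j ∈ S, j ≠ i → eulerForm (d i) (d j) = 0 := by
  classical
  by_contra! hcon
  have hrow : ∀ i ∈ S, ∑ j ∈ S, eulerForm (d i) (d j) ≤ 0 := by
    intro i hi
    obtain ⟨j, hj, hji, hne⟩ := hcon i hi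
    have h1 : ∑ k ∈ (S.erase i).erase j, eulerForm (d i) (d k) ≤ 0 :=
      Finset.sum_nonpos fun k hk =>
        hoff i k (Finset.ne_of_mem_erase (Finset.mem_of_mem_erase hk)).symm
    have h2 := hoff i j hji.symm
    rw [← Finset.add_sum_erase S _ hi, hdiag,
      ← Finset.add_sum_erase _ _ (Finset.mem_erase.2 ⟨hji, hj⟩)]
    lia
  have hq : eulerForm (∑ i ∈ S, d i) (∑ i ∈ S, d i) = 0 := by
    refine le_antisymm ?_ (hQ.eulerForm_nonneg _)
    simp only [eulerForm_sum_left, eulerForm_sum_right]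
    rw [Finset.sum_comm]
    exact Finset.sum_nonpos hrow
  have h0 := hQ.eulerForm_eq_zero_of_isotropic hδ hq
  rw [eulerForm_sum_right] at h0
  rcases hsign with h | h
  · exact (Finset.sum_neg (fun i _ => h i) hS).ne h0
  · exact (Finset.sum_pos (fun i _ => h i) hS).ne' h0

end EulerForm

/-! ### Schur representations -/

namespace QuiverRep

variable {K : Type u} [Field K] {Q : Type v} [Quiver.{w} Q]

theorem IsSchur.finrank_hom {V : QuiverRep K Q} (hV : IsSchur V) :
    Module.finrank K (V ⟶ V) = 1 := by
  obtain ⟨φ⟩ := hV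
  have := φ.toLinearEquiv.finrank_eq
  rw [Module.finrank_self] at this
  exact this

theorem HomVanishes.finrank_hom {V W : QuiverRep K Q} (h : HomVanishes V W) :
    Module.finrank K (V ⟶ W) = 0 := by
  have : Subsingleton (V ⟶ W) := ⟨fun f g => (h f).trans (h g).symm⟩
  exact Module.finrank_zero_of_subsingleton

/-- The projection onto a summand is an idempotent of `End V ≃ K`, hence `0` or `1`. -/
theorem IsSchur.indecomposable {V : QuiverRep K Q} (hV : IsSchur V) : Indecomposable V := by
  obtain ⟨φ⟩ := hV
  refine ⟨fun h => one_ne_zero (α := K) ?_, fun X Y i => ?_⟩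
  · rw [← map_one φ, ← map_zero φ]
    exact congrArg φ (h.eq_of_src _ _)
  · let p : V ⟶ V := i.hom ≫ biprod.fst ≫ biprod.inl ≫ i.inv
    have hp : IsIdempotentElem (φ p) := by
      unfold IsIdempotentElem
      rw [← map_mul]
      congr 1
      change p ≫ p = p
      simp [p]
    rcases IsIdempotentElem.iff_eq_zero_or_one.1 hp with h | h
    · have h0 : p = 0 := φ.injective (h.trans (map_zero φ).symm)
      refine Or.inl ((IsZero.iff_id_eq_zero X).2 ?_)
      calc 𝟙 X = (biprod.inl ≫ i.inv) ≫ p ≫ i.hom ≫ biprod.fst := by simp [p]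
        _ = 0 := by rw [h0, zero_comp, comp_zero]
    · have h1 : p = 𝟙 V := φ.injective (h.trans (map_one φ).symm)
      refine Or.inr ((IsZero.iff_id_eq_zero Y).2 ?_)
      calc 𝟙 Y = (biprod.inr ≫ i.inv) ≫ 𝟙 V ≫ i.hom ≫ biprod.snd := by simp
        _ = (biprod.inr ≫ i.inv) ≫ p ≫ i.hom ≫ biprod.snd := by rw [h1]
        _ = 0 := by simp [p]

open ZeroObject in
theorem isDirectSummand_self (V : QuiverRep K Q) : IsDirectSummand V V :=
  ⟨0, ⟨isoBiprodZero (isZero_zero _)⟩⟩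

end QuiverRep

/-! ### Orthogonal Schur sequences -/

theorem proposition3p6
    {K : Type u} [Field K] [IsAlgClosed K] [CharZero K]
    {Q : Type v} [Quiver.{w} Q] [Fintype Q] [∀ x y : Q, Fintype (x ⟶ y)]
    (hac : IsAcyclicQuiver Q) (hQ : IsEuclideanQuiver Q)
    (δ : Q → ℤ) (hδ : QuiverRep.IsImaginarySchurRoot K δ)
    (r : ℕ) (V : Fin r → QuiverRep K Q)
    (hV : QuiverRep.IsOrthogonalSchurSequence V)
    (htype : (∀ i, QuiverRep.IsPreprojective δ (V i)) ∨
      (∀ i, QuiverRep.IsPreinjective δ (V i))) :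
    ∃ σ : Equiv.Perm (Fin r),
      QuiverRep.IsOrthogonalExceptionalSequence fun i => V (σ i) := by
  obtain ⟨hSchur, horth⟩ := hV
  have hδ0 : eulerForm δ δ = 0 := le_antisymm hδ.2 (hQ.eulerForm_nonneg δ)
  have hsign : (∀ i, eulerForm δ (QuiverRep.dimVec (V i)) < 0) ∨
      (∀ i, 0 < eulerForm δ (QuiverRep.dimVec (V i))) :=
    htype.imp
      (fun h i => h i (V i) (hSchur i).indecomposable (QuiverRep.isDirectSummand_self _))
      (fun h i => h i (V i) (hSchur i).indecomposable (QuiverRep.isDirectSummand_self _))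
  have hdiag : ∀ i, eulerForm (QuiverRep.dimVec (V i)) (QuiverRep.dimVec (V i)) = 1 := by
    intro i
    have hnn := hQ.eulerForm_nonneg (QuiverRep.dimVec (V i))
    -- An isotropic dimension vector would have defect zero.
    have hne : eulerForm (QuiverRep.dimVec (V i)) (QuiverRep.dimVec (V i)) ≠ 0 := fun h =>
      (hsign.elim (fun hs => (hs i).ne) fun hs => (hs i).ne')
        (hQ.eulerForm_eq_zero_of_isotropic hδ0 h)
    have hle := QuiverRep.eulerForm_dimVec (V i) (V i)
    rw [(hSchur i).finrank_hom] at hle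
    lia
  have hoff : ∀ i j, i ≠ j →
      eulerForm (QuiverRep.dimVec (V i)) (QuiverRep.dimVec (V j)) ≤ 0 := by
    intro i j hij
    have hle := QuiverRep.eulerForm_dimVec (V i) (V j)
    rw [(horth i j hij).finrank_hom] at hle
    lia
  obtain ⟨σ, hσ⟩ := exists_perm_forall_lt
    (fun S hS => hQ.exists_forall_eulerForm_eq_zero hdiag hoff hδ0 hsign (S := S) hS)
  have hperp : ∀ i j, i ≠ j → QuiverRep.HomVanishes (V (σ i)) (V (σ j)) := fun i j hij =>
    horth _ _ (σ.injective.ne hij)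
  refine ⟨σ, ⟨fun i => ⟨hSchur _, ?_⟩, fun i j hij => ⟨hperp i j hij.ne, ?_⟩⟩, hperp⟩
  · apply QuiverRep.extVanishes_of_finrank_hom_le
    rw [(hSchur _).finrank_hom, hdiag, Nat.cast_one]
  · apply QuiverRep.extVanishes_of_finrank_hom_le
    rw [(hperp i j hij.ne).finrank_hom, hσ i j hij, Nat.cast_zero]
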